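/- Let $V$ be a real Banach space and let $W$ be a real normed space (not assumed complete). For metric spaces $X$ and $Y$ let $$d_{GH}(X,Y)=\inf_{Z,f,g} d_H\bigl(f(X),g(Y)\bigr)\in[0,\infty],$$ where the infimum is over all metric spaces $Z$ and all isometric embeddings (distance-preserving maps, not assumed surjective) $f\colon X\to Z$ and $g\colon Y\to Z$, and $d_H$ is the Hausdorff distance in $Z$. Then the following conditions are equivalent: 1. there is a linear isometric embedding $W\to V$ whose image is dense in $V$; 2. there is an isometric embedding $W\to V$ (not assumed linear) whose image is dense in $V$; 3. $d_{GH}(V,W)=0$; 4. $d_{GH}(V,W)<\infty$. -/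

import Mathlib

universe u v w

open Metric in
/-- The Gromov-Hausdorff distance between two metric spaces `X` and `Y`, with values in
`[0, ∞]`: the infimum, over all metric spaces `Z` and all isometric embeddings `f : X → Z`,
`g : Y → Z`, of the Hausdorff distance between `f(X)` and `g(Y)`.
The spaces `Z` range over the universe `max u v`; as `gromovHausdorffEDist_le` shows, metric
spaces `Z` in any other universe give nothing smaller. -/
noncomputable def gromovHausdorffEDist (X : Type u) (Y : Type v) [MetricSpace X] [MetricSpace Y] :
    ENNReal :=
  ⨅ (Z : Type (max u v)) (_ : MetricSpace Z) (f : X → Z) (g : Y → Z)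
    (_ : Isometry f) (_ : Isometry g), hausdorffEDist (Set.range f) (Set.range g)

open Metric in
/-- The Gromov-Hausdorff distance is at most the Hausdorff distance of the images under
isometric embeddings in a metric space of an arbitrary universe. -/
theorem gromovHausdorffEDist_le {X : Type u} {Y : Type v} [MetricSpace X] [MetricSpace Y]
    {Z : Type w} [MetricSpace Z] {f : X → Z} {g : Y → Z} (hf : Isometry f) (hg : Isometry g) :
    gromovHausdorffEDist X Y ≤ hausdorffEDist (Set.range f) (Set.range g) := by
  have : Small.{max u v} X := ⟨ULift.{v} X, ⟨Equiv.ulift.symm⟩⟩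
  have : Small.{max u v} Y := ⟨ULift.{u} Y, ⟨Equiv.ulift.symm⟩⟩
  obtain ⟨T, mT, i, f', g', hi, rfl, rfl⟩ : ∃ (T : Type (max u v)) (_ : MetricSpace T) (i : T → Z)
      (f' : X → T) (g' : Y → T), Isometry i ∧ i ∘ f' = f ∧ i ∘ g' = g := by
    let e := equivShrink.{max u v} (Set.range f ∪ Set.range g : Set Z)
    refine ⟨_, MetricSpace.induced (fun t => (e.symm t : Z))
      (Subtype.val_injective.comp e.symm.injective) inferInstance, fun t => (e.symm t : Z),
      fun x => e ⟨f x, Or.inl ⟨x, rfl⟩⟩, fun y => e ⟨g y, Or.inr ⟨y, rfl⟩⟩, fun _ _ => rfl, ?_, ?_⟩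
    · funext x
      simp
    · funext y
      simp
  have hf' : Isometry f' := fun a b => by rw [← hi.edist_eq]; exact hf a b
  have hg' : Isometry g' := fun a b => by rw [← hi.edist_eq]; exact hg a b
  rw [Set.range_comp, Set.range_comp, hausdorffEDist_image hi]
  exact iInf_le_of_le T <| iInf_le_of_le mT <| iInf_le_of_le f' <| iInf_le_of_le g' <|
    iInf_le_of_le hf' <| iInf_le _ hg'

open Filter Topology

/-! Finite Gromov-Hausdorff distance yields a correspondence of finite distortion `ε`, and rescaling
by `2 ^ n` shrinks its distortion to zero. Convergence of the rescalings needs almost-preservation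
of midpoints. This is a coarse version of the reflection proof of Mazur-Ulam: `dist_midpoint_le`
bounds the error at distance `d` by `d / 2 ^ k + (2 + k) * ε`. At scale `2 ^ n`, taking `k = n`
leaves an error linear in `n`, which is summable after division by `2 ^ n`. The limit preserves
distances, midpoints and zero, so it is a linear isometry. -/

/-- A correspondence between `X` and `Y` (a relation that is total on both sides) which distorts
distances by at most `ε`. -/
structure IsAlmostIsometric {X : Type*} {Y : Type*} [PseudoMetricSpace X] [PseudoMetricSpace Y]
    (R : X → Y → Prop) (ε : ℝ) : Prop where
  exists_right : ∀ x, ∃ y, R x y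
  exists_left : ∀ y, ∃ x, R x y
  abs_dist_sub_le : ∀ {x y x' y'}, R x y → R x' y' → |dist x x' - dist y y'| ≤ ε

/-- Two metric spaces at finite Gromov-Hausdorff distance are related by a correspondence of
finite distortion. -/
theorem exists_isAlmostIsometric_of_gromovHausdorffEDist_lt_top {X : Type u} {Y : Type v}
    [MetricSpace X] [MetricSpace Y] (h : gromovHausdorffEDist X Y < ⊤) :
    ∃ (R : X → Y → Prop) (ε : ℝ), IsAlmostIsometric R ε := by
  simp only [gromovHausdorffEDist, iInf_lt_iff] at h
  obtain ⟨Z, mZ, f, g, hf, hg, h⟩ := h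
  obtain ⟨r, hr, -⟩ := ENNReal.lt_iff_exists_nnreal_btwn.1 h
  refine ⟨fun x y => dist (f x) (g y) ≤ r, 2 * r, fun x => ?_, fun y => ?_, ?_⟩
  · obtain ⟨_, ⟨y, rfl⟩, hy⟩ :=
      Metric.exists_edist_lt_of_hausdorffEDist_lt (Set.mem_range_self x) hr
    exact ⟨y, (edist_lt_coe.1 hy).le⟩
  · rw [Metric.hausdorffEDist_comm] at hr
    obtain ⟨_, ⟨x, rfl⟩, hx⟩ :=
      Metric.exists_edist_lt_of_hausdorffEDist_lt (Set.mem_range_self y) hr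
    exact ⟨x, by rw [dist_comm]; exact (edist_lt_coe.1 hx).le⟩
  · intro x y x' y' h h'
    rw [← hf.dist_eq, ← hg.dist_eq]
    have h₁ := dist_triangle4 (f x) (g y) (g y') (f x')
    have h₂ := dist_triangle4 (g y) (f x) (f x') (g y')
    rw [dist_comm (g y') (f x')] at h₁
    rw [dist_comm (g y) (f x)] at h₂
    rw [abs_le]
    constructor <;> linarith

namespace IsAlmostIsometric

section Metric

variable {X : Type*} {Y : Type*} [PseudoMetricSpace X] [PseudoMetricSpace Y]
  {R : X → Y → Prop} {ε : ℝ}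

theorem flip (hR : IsAlmostIsometric R ε) : IsAlmostIsometric (fun y x => R x y) ε :=
  ⟨hR.exists_left, hR.exists_right, fun h h' => by
    rw [abs_sub_comm]; exact hR.abs_dist_sub_le h h'⟩

theorem dist_left_le (hR : IsAlmostIsometric R ε) {x x' : X} {y y' : Y} (h : R x y)
    (h' : R x' y') : dist x x' ≤ dist y y' + ε := by
  linarith [(abs_le.1 (hR.abs_dist_sub_le h h')).2]

theorem dist_right_le (hR : IsAlmostIsometric R ε) {x x' : X} {y y' : Y} (h : R x y)
    (h' : R x' y') : dist y y' ≤ dist x x' + ε :=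
  hR.flip.dist_left_le h h'

end Metric

variable {E : Type*} {F : Type*} [NormedAddCommGroup E] [NormedAddCommGroup F]
  {R : E → F → Prop} {ε : ℝ}

/-- Conjugating a reflection of `F` by a correspondence between `E` and `F`, and composing with a
reflection of `E`, gives a correspondence between `E` and itself. The reflections are
`x ↦ s - x` and `y ↦ t - y`. -/
theorem reflect (hR : IsAlmostIsometric R ε) (s : E) (t : F) :
    IsAlmostIsometric (fun x w => ∃ y, R x y ∧ R (s - w) (t - y)) (2 * ε) := by
  refine ⟨fun x => ?_, fun w => ?_, ?_⟩
  · obtain ⟨y, hy⟩ := hR.exists_right x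
    obtain ⟨z, hz⟩ := hR.exists_left (t - y)
    exact ⟨s - z, y, hy, by simpa using hz⟩
  · obtain ⟨y, hy⟩ := hR.exists_right (s - w)
    obtain ⟨x, hx⟩ := hR.exists_left (t - y)
    exact ⟨x, t - y, hx, by simpa using hy⟩
  · rintro x w x' w' ⟨y, h₁, h₂⟩ ⟨y', h₁', h₂'⟩
    have h := abs_le.1 (hR.abs_dist_sub_le h₁ h₁')
    have h' := abs_le.1 (hR.abs_dist_sub_le h₂ h₂')
    rw [dist_sub_left, dist_sub_left] at h'
    rw [abs_le]
    constructor <;> linarith [h.1, h.2, h'.1, h'.2]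

variable [NormedSpace ℝ E] [NormedSpace ℝ F]

/-- If reflecting a correspondence moves the midpoint `m` of `a` and `b` by little, then the
correspondence almost preserves that midpoint. -/
theorem dist_midpoint_le_of_reflect (hR : IsAlmostIsometric R ε) {a b : E} {a' b' p : F} {c : ℝ}
    (hp : R (midpoint ℝ a b) p)
    (hc : ∀ w, (∃ y, R (midpoint ℝ a b) y ∧ R (a + b - w) (a' + b' - y)) →
      dist w (midpoint ℝ a b) ≤ c) :
    dist p (midpoint ℝ a' b') ≤ (c + ε) / 2 := by
  -- The reflected relation sends the midpoint to `a + b - z`, so `z` is within `c` of the midpoint.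
  -- Hence `p` is within `c + ε` of its reflection, which is twice its distance from the centre.
  obtain ⟨z, hz⟩ := hR.exists_left (a' + b' - p)
  have h₁ := hc (a + b - z) ⟨p, hp, by simpa using hz⟩
  have h₂ := hR.dist_right_le hp hz
  have e₁ : dist (a + b - z) (midpoint ℝ a b) = dist (midpoint ℝ a b) z := by
    rw [dist_eq_norm, dist_eq_norm, midpoint_eq_smul_add, invOf_eq_inv]
    congr 1
    module
  have e₂ : dist p (a' + b' - p) = 2 * dist p (midpoint ℝ a' b') := by
    rw [dist_eq_norm, dist_eq_norm, midpoint_eq_smul_add, invOf_eq_inv,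
      ← Real.norm_of_nonneg (zero_le_two (α := ℝ)), ← norm_smul, Real.norm_of_nonneg zero_le_two]
    congr 1
    module
  linarith

/-- A correspondence of a space with itself that fixes `a` and `b` almost fixes their midpoint. -/
theorem dist_midpoint_le_of_self (k : ℕ) {R : E → E → Prop} {ε : ℝ} (hR : IsAlmostIsometric R ε)
    {a b p : E} (ha : R a a) (hb : R b b) (hp : R (midpoint ℝ a b) p) :
    dist p (midpoint ℝ a b) ≤ (1 / 2) ^ k * dist a b + (1 + k / 2) * ε := by
  induction k generalizing R ε p with
  | zero =>
    have h₁ := hR.dist_right_le hp ha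
    have h₂ := dist_triangle p a (midpoint ℝ a b)
    rw [dist_midpoint_left] at h₁
    rw [dist_left_midpoint] at h₂
    norm_num at h₁ h₂ ⊢
    linarith
  | succ k ih =>
    -- The reflections swap `a` and `b`, so the new relation still fixes both. Its distortion `2 *
    -- ε` is offset by the halving, so the error grows only linearly in `k`.
    refine (hR.dist_midpoint_le_of_reflect hp fun w hw =>
      ih (hR.reflect (a + b) (a + b)) ⟨a, ha, ?_⟩ ⟨b, hb, ?_⟩ hw).trans_eq ?_
    · simpa using hb
    · simpa using ha
    · push_cast
      ring

/-- A correspondence of bounded distortion preserves midpoints up to an error which is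
logarithmic in the distance of the end points. -/
theorem dist_midpoint_le (hR : IsAlmostIsometric R ε) (k : ℕ) {a b : E} {a' b' p : F}
    (ha : R a a') (hb : R b b') (hp : R (midpoint ℝ a b) p) :
    dist p (midpoint ℝ a' b') ≤ (1 / 2) ^ k * dist a b + (2 + k) * ε := by
  have hε : 0 ≤ ε := (abs_nonneg _).trans (hR.abs_dist_sub_le ha hb)
  refine (hR.dist_midpoint_le_of_reflect hp fun w hw =>
    dist_midpoint_le_of_self k (hR.reflect (a + b) (a' + b')) ⟨a', ha, ?_⟩ ⟨b', hb, ?_⟩ hw).trans ?_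
  · simpa using hb
  · simpa using ha
  · have h₁ : 0 ≤ (1 / 2 : ℝ) ^ k * dist a b := by positivity
    have h₂ : 0 ≤ (k : ℝ) * ε := by positivity
    linarith

/-- Points corresponding to `2 ^ n • x`, rescaled by `2 ^ n`, form a Cauchy sequence. -/
theorem cauchySeq_smul (hR : IsAlmostIsometric R ε) {f : E → F} (hf : ∀ x, R x (f x)) (x : E) :
    CauchySeq fun n : ℕ => (1 / 2 : ℝ) ^ n • f ((2 : ℝ) ^ n • x) := by
  have hs : Summable fun n : ℕ => ((1 / 2 : ℝ) ^ n) * (‖f 0‖ / 2 + 2 * ‖x‖ + 2 * ε) +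
      (n : ℝ) ^ 1 * (1 / 2 : ℝ) ^ n * ε :=
    (summable_geometric_two.mul_right _).add
      ((summable_pow_mul_geometric_of_norm_lt_one (R := ℝ) 1
        (by norm_num : ‖(1 / 2 : ℝ)‖ < 1)).mul_right _)
  refine cauchySeq_of_dist_le_of_summable _ (fun n => ?_) hs
  have hmid : midpoint ℝ (0 : E) ((2 : ℝ) ^ (n + 1) • x) = (2 : ℝ) ^ n • x := by
    rw [midpoint_eq_smul_add, invOf_eq_inv, zero_add, smul_smul, pow_succ]
    congr 1
    ring
  have h := hR.dist_midpoint_le n (hf 0) (hf ((2 : ℝ) ^ (n + 1) • x)) (hf _)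
  rw [hmid, dist_zero_left, norm_smul, norm_pow, Real.norm_two, dist_eq_norm] at h
  have hpow : (1 / 2 : ℝ) ^ n * 2 ^ n = 1 := by rw [← mul_pow]; norm_num
  have hpow' : (1 / 2 : ℝ) ^ n * (2 ^ (n + 1) * ‖x‖) = 2 * ‖x‖ := by
    linear_combination (2 * ‖x‖) * hpow
  rw [hpow'] at h
  set y := f ((2 : ℝ) ^ n • x)
  set z := f ((2 : ℝ) ^ (n + 1) • x)
  -- Since `f 0` need not vanish, `(1 / 2) • z` differs from the midpoint of `f 0` and `z` by `(1 /
  -- 2) • f 0`.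
  have e : (1 / 2 : ℝ) ^ n • y - (1 / 2 : ℝ) ^ (n + 1) • z =
      (1 / 2 : ℝ) ^ n • ((y - midpoint ℝ (f 0) z) + (1 / 2 : ℝ) • f 0) := by
    rw [midpoint_eq_smul_add, invOf_eq_inv, pow_succ]
    module
  have h' : ‖(y - midpoint ℝ (f 0) z) + (1 / 2 : ℝ) • f 0‖ ≤
      2 * ‖x‖ + (2 + n) * ε + ‖f 0‖ / 2 := by
    refine (norm_add_le _ _).trans ?_
    rw [norm_smul, Real.norm_of_nonneg (by norm_num : (0 : ℝ) ≤ 1 / 2)]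
    linarith
  rw [dist_eq_norm, e, norm_smul, Real.norm_of_nonneg (by positivity)]
  refine (mul_le_mul_of_nonneg_left h' (by positivity)).trans_eq ?_
  ring

theorem tendsto_half_pow_mul (c : ℝ) : Tendsto (fun n : ℕ => (1 / 2 : ℝ) ^ n * c) atTop (𝓝 0) := by
  simpa using (tendsto_pow_atTop_nhds_zero_of_lt_one (by norm_num : (0 : ℝ) ≤ 1 / 2)
    (by norm_num)).mul_const c

theorem dist_half_pow_smul (n : ℕ) (y z : F) :
    dist ((1 / 2 : ℝ) ^ n • y) ((1 / 2 : ℝ) ^ n • z) = (1 / 2) ^ n * dist y z := by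
  rw [dist_smul₀, Real.norm_of_nonneg (by positivity)]

theorem half_pow_smul_two_pow_smul (n : ℕ) (x : E) : (1 / 2 : ℝ) ^ n • (2 : ℝ) ^ n • x = x := by
  rw [smul_smul, ← mul_pow]
  norm_num

/-- The rescaled limit of a correspondence of bounded distortion is a linear isometry with dense
range. -/
theorem exists_linearIsometry_denseRange [CompleteSpace F] (hR : IsAlmostIsometric R ε) :
    ∃ U : E →ₗᵢ[ℝ] F, DenseRange U := by
  choose f hf using hR.exists_right
  choose g hg using hR.exists_left
  choose U hU using fun x => cauchySeq_tendsto_of_complete (hR.cauchySeq_smul hf x)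
  have hscale : ∀ n : ℕ, ∀ x y : E,
      dist x y = (1 / 2 : ℝ) ^ n * dist ((2 : ℝ) ^ n • x) ((2 : ℝ) ^ n • y) := fun n x y => by
    rw [← dist_half_pow_smul, half_pow_smul_two_pow_smul, half_pow_smul_two_pow_smul]
  have hiso : Isometry U := by
    refine Isometry.of_dist_eq fun x y => tendsto_nhds_unique ((hU x).dist (hU y)) ?_
    refine tendsto_iff_dist_tendsto_zero.2
      (squeeze_zero (fun _ => dist_nonneg) (fun n => ?_) (tendsto_half_pow_mul ε))
    rw [dist_half_pow_smul, hscale n x y, Real.dist_eq, ← mul_sub, abs_mul,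
      abs_of_nonneg (by positivity), abs_sub_comm]
    exact mul_le_mul_of_nonneg_left (hR.abs_dist_sub_le (hf _) (hf _)) (by positivity)
  have hzero : U 0 = 0 := by
    refine tendsto_nhds_unique (hU 0) (squeeze_zero_norm (fun n => ?_) (tendsto_half_pow_mul ‖f 0‖))
    rw [smul_zero, norm_smul, Real.norm_of_nonneg (by positivity)]
  have hmid : ∀ x y, U (midpoint ℝ x y) = midpoint ℝ (U x) (U y) := by
    intro x y
    have h : Tendsto (fun n : ℕ => midpoint ℝ ((1 / 2 : ℝ) ^ n • f ((2 : ℝ) ^ n • x))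
        ((1 / 2 : ℝ) ^ n • f ((2 : ℝ) ^ n • y))) atTop (𝓝 (midpoint ℝ (U x) (U y))) := by
      simp only [midpoint_eq_smul_add]
      exact ((hU x).add (hU y)).const_smul _
    refine tendsto_nhds_unique (hU _) (h.congr_dist ?_)
    have hlim : Tendsto (fun n : ℕ => (1 / 2 : ℝ) ^ n * (dist x y + 2 * ε) +
        (n : ℝ) ^ 1 * (1 / 2 : ℝ) ^ n * ε) atTop (𝓝 0) := by
      simpa using (tendsto_half_pow_mul (dist x y + 2 * ε)).add
        ((tendsto_pow_const_mul_const_pow_of_lt_one 1 (by norm_num : (0 : ℝ) ≤ 1 / 2)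
          (by norm_num)).mul_const ε)
    refine squeeze_zero (fun _ => dist_nonneg) (fun n => ?_) hlim
    have e₁ : midpoint ℝ ((1 / 2 : ℝ) ^ n • f ((2 : ℝ) ^ n • x))
        ((1 / 2 : ℝ) ^ n • f ((2 : ℝ) ^ n • y)) =
        (1 / 2 : ℝ) ^ n • midpoint ℝ (f ((2 : ℝ) ^ n • x)) (f ((2 : ℝ) ^ n • y)) := by
      simp only [midpoint_eq_smul_add]
      module
    have e₂ : (2 : ℝ) ^ n • midpoint ℝ x y = midpoint ℝ ((2 : ℝ) ^ n • x) ((2 : ℝ) ^ n • y) := by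
      simp only [midpoint_eq_smul_add]
      module
    have hd := hR.dist_midpoint_le n (hf ((2 : ℝ) ^ n • x)) (hf ((2 : ℝ) ^ n • y)) (hf _)
    rw [← hscale] at hd
    rw [e₁, e₂, dist_half_pow_smul, dist_comm]
    refine (mul_le_mul_of_nonneg_left hd (by positivity)).trans_eq ?_
    ring
  let L : E →ₗ[ℝ] F :=
    (AddMonoidHom.ofMapMidpoint ℝ ℝ U hzero hmid).toRealLinearMap hiso.continuous |>.toLinearMap
  refine ⟨⟨L, fun x => ?_⟩, Metric.denseRange_iff.2 fun v r hr => ?_⟩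
  · change ‖U x‖ = ‖x‖
    simpa [hzero] using hiso.dist_eq x 0
  · obtain ⟨N, hN⟩ := Metric.cauchySeq_iff'.1 (hR.flip.cauchySeq_smul hg v) (r / 2) (half_pos hr)
    -- As `E` may be incomplete, the rescaled `g` need not converge; a late term of its Cauchy
    -- sequence serves as an approximate preimage of `v`.
    set w := (1 / 2 : ℝ) ^ N • g ((2 : ℝ) ^ N • v)
    refine ⟨w, ?_⟩
    change dist v (U w) < r
    suffices h : dist (U w) v ≤ r / 2 + 0 by rw [dist_comm]; linarith
    refine le_of_tendsto_of_tendsto ((hU w).dist tendsto_const_nhds)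
      (tendsto_const_nhds.add (tendsto_half_pow_mul ε)) ?_
    -- `2 ^ n • w` is within `2 ^ n * (r / 2)` of `g (2 ^ n • v)`, so its image under `f` is within
    -- that plus `ε` of `2 ^ n • v`.
    filter_upwards [eventually_ge_atTop N] with n hn
    have h₁ := (hN n hn).le
    rw [dist_comm, hscale n, smul_comm ((2 : ℝ) ^ n) ((1 / 2 : ℝ) ^ n),
      half_pow_smul_two_pow_smul] at h₁
    have h₂ := hR.dist_right_le (hf ((2 : ℝ) ^ n • w)) (hg ((2 : ℝ) ^ n • v))
    conv_lhs => rw [← half_pow_smul_two_pow_smul n v, dist_half_pow_smul]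
    refine (mul_le_mul_of_nonneg_left h₂ (by positivity)).trans ?_
    rw [mul_add]
    gcongr

end IsAlmostIsometric

/-- A metric space with a dense isometric copy in another one is at Gromov-Hausdorff distance zero
from it. -/
theorem gromovHausdorffEDist_eq_zero_of_denseRange {X : Type u} {Y : Type v} [MetricSpace X]
    [MetricSpace Y] {f : Y → X} (hf : Isometry f) (hd : DenseRange f) :
    gromovHausdorffEDist X Y = 0 := by
  refine le_antisymm ((gromovHausdorffEDist_le isometry_id hf).trans_eq ?_) zero_le
  rw [Metric.hausdorffEDist_zero_iff_closure_eq_closure, hd.closure_range, Set.range_id,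
    closure_univ]

theorem mainTheorem2 {V : Type u} {W : Type v}
    [NormedAddCommGroup V] [NormedSpace ℝ V] [CompleteSpace V]
    [NormedAddCommGroup W] [NormedSpace ℝ W] :
    List.TFAE [
      ∃ U : W →ₗᵢ[ℝ] V, DenseRange U,
      ∃ f : W → V, Isometry f ∧ DenseRange f,
      gromovHausdorffEDist V W = 0,
      gromovHausdorffEDist V W < ⊤] := by
  tfae_have 1 → 2 := fun ⟨U, hU⟩ => ⟨U, U.isometry, hU⟩
  tfae_have 2 → 3 := fun ⟨_, hf, hd⟩ => gromovHausdorffEDist_eq_zero_of_denseRange hf hd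
  tfae_have 3 → 4 := fun h => h ▸ ENNReal.zero_lt_top
  tfae_have 4 → 1 := fun h => by
    obtain ⟨R, ε, hR⟩ := exists_isAlmostIsometric_of_gromovHausdorffEDist_lt_top h
    exact hR.flip.exists_linearIsometry_denseRange
  tfae_finish
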